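/- Notation. For $a\in\mathbb R$ let $\mathbb C_a^{+}=\{\operatorname{Im}z>a\}$, $\mathbb C_a^{-}=\{\operatorname{Im}z<a\}$, $\mathbb C^\pm=\mathbb C_0^\pm$, $b^{a}_\mu(z)=\frac{z-\mu}{z-\overline\mu-2ia}$, $\rho_a(z,\mu)=|b^a_\mu(z)|$, $b_\mu=b^0_\mu$ and $\rho=\rho_0$. A set $A\subset\mathbb C_a^{\pm}$ satisfies the Carleson condition if $\inf_{\lambda\in A}\prod_{\mu\in A,\mu\ne\lambda}\rho_a(\lambda,\mu)>0$, and is $N$-Carleson in $\mathbb C_a^\pm$ if it is a disjoint union of $N$ (possibly empty) sets satisfying the Carleson condition. Let $N\ge1$ be an integer, $\tau>0$, $1<p<\infty$, and let $\Lambda\subset\mathbb C$ be such that $\Lambda\cap\mathbb C_a^{+}$ and $\Lambda\cap\mathbb C_a^{-}$ are $N$-Carleson in $\mathbb C_a^+$ and $\mathbb C_a^-$, respectively, for every $a\in\mathbb R$. Adapted partitions. Let $\epsilon>0$. Partition $\Lambda\cap\mathbb C^{+}$ and $\Lambda\cap\mathbb C^{-}$ into non-empty blocks $\sigma$ with $|\sigma|\le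 N$ such that (a) in each of the two half-planes the generalized Carleson condition holds: for some $\delta>0$, $\prod_{\lambda\in\Lambda\cap\mathbb C^\pm}\rho(z,\lambda)\ge\delta\inf_{\sigma}\prod_{\lambda\in\sigma}\rho(z,\lambda)$ for all $z\in\mathbb C^\pm$, the infimum being over the blocks in $\mathbb C^\pm$; (b) the supremum over all blocks $\sigma$ of their $\rho$-diameters is less than $\epsilon/2$ and less than $1$. Keep the blocks $\sigma$ that do not meet $\{|\operatorname{Im}z|<\epsilon\}$, and partition the set of the remaining points of $\Lambda$ (including its real points) into non-empty blocks $\sigma'$ with $|\sigma'|\le N$ and $\sup_{\sigma'}\operatorname{diam}(\sigma')<\epsilon/2$ such that, for some $\delta>0$, the mutual distances of the sets $\{z\in\mathbb C:\prod_{\lambda\in\sigma'}|z-\lambda|\le\delta\}$ are bounded below by a positive constant. The kept blocks $\sigma$ and the blocks $\sigma'$ together form a partition $(\tau_n)_n$ of $\Lambda$. Enumerate each $\tau_n=\{\lambda_{n,1},\dots,\lambda_{n,|\tau_n|}\}$ and choose a point $\lambda_{n,0}\in\tau_n$, both arbitrarily. The sequence space. For $v:\tau_n\to\mathbb C$ define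 the divided differences $D^k_n v$, $0\le k<|\tau_n|$, by $D_n^kv=D^k_n v(\lambda_{n,k+1})$, where $D_n^0v(z)=v(z)$ and $D_n^{k}v(z)=\bigl(D_n^{k-1}v(z)-D_n^{k-1}v(\lambda_{n,k})\bigr)/\beta_{\lambda_{n,k}}(z)$, with $\beta_\mu(z)=b_\mu(z)$ if $\tau_n$ is a kept block $\sigma$, and $\beta_\mu(z)=z-\mu$ if $\tau_n$ is a block $\sigma'$. Let $e_n(z)=e^{i\tau z}$ if $\tau_n$ meets $\{\operatorname{Im}z\ge0\}$ and $e_n(z)=e^{-i\tau z}$ otherwise. Let $X^p_{\tau,\epsilon}(\Lambda)$ be the space of all $a:\Lambda\to\mathbb C$ with $$\|a\|^p_{X^p_{\tau,\epsilon}(\Lambda)}=\sum_n\bigl(1+|\operatorname{Im}\lambda_{n,0}|\bigr)\sum_{k=0}^{|\tau_n|-1}\bigl|D_n^{k}\bigl((a\,e_n)|_{\tau_n}\bigr)\bigr|^p<\infty .$$ Let $PW^p_\tau$ be the space of entire functions $f$ of exponential type at most $\tau$ with $\|f\|_p^p=\int_{\mathbb R}|f(x)|^p\,dx<\infty$, and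 let $R_\Lambda f=(f(\lambda))_{\lambda\in\Lambda}$. Proposition. Suppose that for some $\epsilon>0$ and some choice of the adapted partition, of the enumerations and of the points $\lambda_{n,0}$, the operator $R_\Lambda$ is an isomorphism of normed spaces (a bijection that is bounded with bounded inverse) from $PW^p_\tau$ onto $X^p_{\tau,\epsilon}(\Lambda)$. Then $\Lambda$ is relatively dense: there is $r>0$ such that $d(x,\Lambda)=\inf_{\lambda\in\Lambda}|x-\lambda|<r$ for all $x\in\mathbb R$. -/

import Mathlib

noncomputable section

namespace PaleyWiener

/-- The half-plane `Im z > a`. -/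
def upperHP (a : ℝ) : Set ℂ := {z | a < z.im}

/-- The half-plane `Im z < a`. -/
def lowerHP (a : ℝ) : Set ℂ := {z | z.im < a}

/-- The Blaschke factor `b_μ(z) = (z - μ) / (z - conj μ - 2 i a)`; the same formula serves both
half-planes `Im z > a` and `Im z < a`. -/
def blaschke (a : ℝ) (μ z : ℂ) : ℂ :=
  (z - μ) / (z - (starRingEnd ℂ) μ - 2 * Complex.I * (a : ℂ))

/-- The pseudohyperbolic distance. -/
def rho (a : ℝ) (z μ : ℂ) : ℝ := ‖blaschke a μ z‖

/-- `∏_{μ ∈ A} ρ_a(z, μ)`, the modulus at `z` of the Blaschke product with zero set `A`. For `z`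
and `A` in one of the half-planes all factors lie in `[0, 1]`, so that the (possibly infinite)
product is the infimum of its finite partial products. -/
def blaschkeAbs (a : ℝ) (A : Set ℂ) (z : ℂ) : ℝ :=
  ⨅ F : {F : Finset ℂ // (F : Set ℂ) ⊆ A}, ∏ μ ∈ F.1, rho a z μ

/-- The Carleson condition for a set contained in one of the half-planes bounded by `Im z = a`. -/
def IsCarleson (a : ℝ) (A : Set ℂ) : Prop :=
  ∃ δ : ℝ, 0 < δ ∧ ∀ l ∈ A, δ ≤ blaschkeAbs a (A \ {l}) l

/-- `A` is a disjoint union of `N` (possibly empty) sets satisfying the Carleson condition. -/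
def IsNCarleson (N : ℕ) (a : ℝ) (A : Set ℂ) : Prop :=
  ∃ P : Fin N → Set ℂ, Pairwise (fun i j => Disjoint (P i) (P j)) ∧ (⋃ i, P i) = A ∧
    ∀ i, IsCarleson a (P i)

/-- `A ∩ {Im z > a}` and `A ∩ {Im z < a}` are `N`-Carleson, for every real `a`. -/
def IsNCarlesonInEveryHalfPlane (N : ℕ) (A : Set ℂ) : Prop :=
  ∀ a : ℝ, IsNCarleson N a (A ∩ upperHP a) ∧ IsNCarleson N a (A ∩ lowerHP a)

/-- `P` is a partition of `A` into non-empty finite blocks with at most `N` elements. -/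
structure IsBlockPartition (N : ℕ) (P : Set (Finset ℂ)) (A : Set ℂ) : Prop where
  nonempty : ∀ s ∈ P, s.Nonempty
  card_le : ∀ s ∈ P, s.card ≤ N
  disjoint : ∀ s ∈ P, ∀ t ∈ P, s ≠ t → Disjoint s t
  union : (⋃ s ∈ P, (s : Set ℂ)) = A

/-- The generalized Carleson condition `|B(z)| ≥ δ inf_n |B_n(z)|` in the half-plane `U`, bounded
by `Im z = a`, for the Blaschke products `B` of `A` and `B_n` of the blocks of `A`. -/
def GeneralizedCarleson (a : ℝ) (U A : Set ℂ) (P : Set (Finset ℂ)) : Prop :=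
  ∃ δ : ℝ, 0 < δ ∧ ∀ z ∈ U, δ * (⨅ s : P, ∏ μ ∈ s.1, rho a z μ) ≤ blaschkeAbs a A z

/-- The blocks that do not meet the strip `|Im z| < ε`. -/
def farBlocks (ε : ℝ) (P : Set (Finset ℂ)) : Set (Finset ℂ) :=
  {s ∈ P | ∀ z ∈ s, ε ≤ |z.im|}

/-- The set `{z : ∏_{l ∈ s} |z - l| ≤ δ}`. -/
def lemniscate (δ : ℝ) (s : Finset ℂ) : Set ℂ := {z | ∏ l ∈ s, ‖z - l‖ ≤ δ}

/-- A partition of `Λ` adapted to `ε`, together with the choices that enter the norm. The sets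
`Λ ∩ {Im z > 0}` and `Λ ∩ {Im z < 0}` are first split into pseudohyperbolically small blocks
satisfying the generalized Carleson condition. The blocks that avoid the strip `|Im z| < ε` are
kept; what remains of `Λ` is split again into blocks `near` that are small and separated
in the Euclidean sense. -/
structure AdaptedPartition (N : ℕ) (ε : ℝ) (Λ : Set ℂ) where
  /-- blocks in the upper half-plane -/
  upper : Set (Finset ℂ)
  /-- blocks in the lower half-plane -/
  lower : Set (Finset ℂ)
  /-- blocks of the points close to the real axis -/
  near : Set (Finset ℂ)
  upper_partition : IsBlockPartition N upper (Λ ∩ upperHP 0)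
  lower_partition : IsBlockPartition N lower (Λ ∩ lowerHP 0)
  upper_carleson : GeneralizedCarleson 0 (upperHP 0) (Λ ∩ upperHP 0) upper
  lower_carleson : GeneralizedCarleson 0 (lowerHP 0) (Λ ∩ lowerHP 0) lower
  rho_diam : ∃ ρ₀ : ℝ, ρ₀ < ε / 2 ∧ ρ₀ < 1 ∧
    ∀ s ∈ upper ∪ lower, ∀ z ∈ s, ∀ w ∈ s, rho 0 z w ≤ ρ₀
  near_partition :
    IsBlockPartition N near (Λ \ ⋃ s ∈ farBlocks ε (upper ∪ lower), (s : Set ℂ))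
  near_diam : ∃ d : ℝ, d < ε / 2 ∧ ∀ s ∈ near, ∀ z ∈ s, ∀ w ∈ s, dist z w ≤ d
  near_separated : ∃ δ : ℝ, 0 < δ ∧ ∃ η : ℝ, 0 < η ∧ ∀ s ∈ near, ∀ t ∈ near, s ≠ t →
    ∀ z ∈ lemniscate δ s, ∀ w ∈ lemniscate δ t, η ≤ dist z w
  /-- an enumeration of each block -/
  node : ∀ s : Finset ℂ, Fin s.card ≃ s
  /-- a distinguished point of each block -/
  base : Finset ℂ → ℂ
  base_mem : ∀ s ∈ farBlocks ε (upper ∪ lower) ∪ near, base s ∈ s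

/-- Divided differences with respect to `b`, for nodes `μ₀, …, μ_{m-1}` and values
`v₀, …, v_{m-1}`: `dividedDiff b μ v k i` is the `k`-th divided difference of
`v₀, …, v_{k-1}, v_i`. -/
def dividedDiff (b : ℂ → ℂ → ℂ) {m : ℕ} (μ v : Fin m → ℂ) : ℕ → Fin m → ℂ
  | 0, i => v i
  | k + 1, i =>
    if h : k < m then
      (dividedDiff b μ v k i - dividedDiff b μ v k ⟨k, h⟩) / b (μ ⟨k, h⟩) (μ i)
    else 0

open Classical in
/-- The exponential factor on the block `s`: `e^{iτz}` if `s` meets `Im z ≥ 0`, and `e^{-iτz}`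
otherwise. -/
def expFactor (τ : ℝ) (s : Finset ℂ) (z : ℂ) : ℂ :=
  if ∃ w ∈ s, 0 ≤ w.im then Complex.exp (Complex.I * τ * z) else Complex.exp (-Complex.I * τ * z)

open Classical in
/-- The sequence `a`, extended by zero to `ℂ`. -/
def extendZero {Λ : Set ℂ} (a : Λ → ℂ) (z : ℂ) : ℂ := if h : z ∈ Λ then a ⟨z, h⟩ else 0

namespace AdaptedPartition

variable {N : ℕ} {ε : ℝ} {Λ : Set ℂ}

/-- The blocks of the final partition of `Λ`. -/
def blocks (P : AdaptedPartition N ε Λ) : Set (Finset ℂ) :=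
  farBlocks ε (P.upper ∪ P.lower) ∪ P.near

open Classical in
/-- The kernel of the divided differences on a block: Euclidean on the blocks close to the real
axis, pseudohyperbolic on the other ones. -/
def kernel (P : AdaptedPartition N ε Λ) (s : Finset ℂ) : ℂ → ℂ → ℂ :=
  if s ∈ P.near then fun μ z => z - μ else blaschke 0

/-- The `k`-th divided difference of `a e^{±iτ·}` at the first `k + 1` points of the block `s`. -/
def blockDiff (P : AdaptedPartition N ε Λ) (τ : ℝ) (a : Λ → ℂ) (s : Finset ℂ)
    (k : Fin s.card) : ℂ :=
  dividedDiff (P.kernel s) (fun i => (P.node s i : ℂ))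
    (fun i => extendZero a (P.node s i) * expFactor τ s (P.node s i)) k k

/-- The `p`-th power of the norm, as an element of `[0, ∞]`. -/
def normPow (P : AdaptedPartition N ε Λ) (τ p : ℝ) (a : Λ → ℂ) : ENNReal :=
  ∑' s : P.blocks, ENNReal.ofReal
    ((1 + |(P.base s.1).im|) * ∑ k : Fin s.1.card, ‖P.blockDiff τ a s.1 k‖ ^ p)

/-- The sequence space. -/
def X (P : AdaptedPartition N ε Λ) (τ p : ℝ) : Set (Λ → ℂ) :=
  {a | P.normPow τ p a < ⊤}

/-- The norm of the sequence space. -/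
def normX (P : AdaptedPartition N ε Λ) (τ p : ℝ) (a : Λ → ℂ) : ℝ :=
  (P.normPow τ p a).toReal ^ (1 / p)

end AdaptedPartition

/-- The Paley–Wiener space: entire functions of exponential type at most `τ` whose restriction
to the real line is in `L^p`. -/
def PW (τ p : ℝ) : Set (ℂ → ℂ) :=
  {f | Differentiable ℂ f ∧
    (∀ η : ℝ, 0 < η → ∃ C : ℝ, ∀ z : ℂ, ‖f z‖ ≤ C * Real.exp ((τ + η) * ‖z‖)) ∧
    MeasureTheory.Integrable (fun x : ℝ => ‖f (x : ℂ)‖ ^ p)}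

/-- The norm of the Paley–Wiener space. -/
def normPW (p : ℝ) (f : ℂ → ℂ) : ℝ := (∫ x : ℝ, ‖f (x : ℂ)‖ ^ p) ^ (1 / p)

/-- The restriction operator. -/
def restriction (Λ : Set ℂ) (f : ℂ → ℂ) : Λ → ℂ := fun l => f l

/-- The restriction operator (which is linear) is an isomorphism of normed spaces from the
Paley–Wiener space onto the sequence space: a bijection, bounded with bounded inverse. -/
def RestrictionIsIsomorphism {N : ℕ} {ε : ℝ} {Λ : Set ℂ} (P : AdaptedPartition N ε Λ)
    (τ p : ℝ) : Prop :=
  Set.BijOn (restriction Λ) (PW τ p) (P.X τ p) ∧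
    ∃ c C : ℝ, 0 < c ∧ 0 < C ∧ ∀ f ∈ PW τ p,
      c * normPW p f ≤ P.normX τ p (restriction Λ f) ∧
      P.normX τ p (restriction Λ f) ≤ C * normPW p f

/-- `Λ` is relatively dense: the distances `d(x, Λ)`, `x` real, are bounded by some `r`
(the distance to the empty set is infinite). -/
def RelativelyDense (Λ : Set ℂ) : Prop :=
  ∃ r : ℝ, 0 < r ∧ ∀ x : ℝ, Metric.infEDist (x : ℂ) Λ < ENNReal.ofReal r

end PaleyWiener

end

/-! If `Λ` keeps distance `R` from a real point `x`, an estimate of the sampled norms fails for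
large `R`. Take `f(z) = (sin(τz/2)/z)²`, of exponential type `τ`, and translate it to `x`. It decays
quadratically, so after multiplication by the exponential factor all its divided differences on a
block are at most `K/|l-x|²`, for any point `l` of the block (`exists_norm_blockDiff_mul_le`, via
the maximum principle). The functions `sin(τz)/z` centred at `x` and at `x + π/(2τ)` decay only
linearly, and their zeros do not coincide: at `l`, one of the two has size at least a constant times
`1/|l-x|` after the same normalization (`exp_abs_im_le_norm_sincScaled_add`).

Block by block, the sampled norm of the translate of `f` is therefore `O(1/R)` times those of the
other two (`exists_normPow_le`). Translation preserves the Paley–Wiener norm, so the isomorphism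
bounds the former below and the latter above, independently of `x`. This bounds `R`. -/

namespace PaleyWiener

/-! ### Divided differences and the maximum principle -/

/-- Generalized divided differences of an entire function `F` are controlled, by the maximum
principle, by the supremum of `F` over a bounded set `U` containing the nodes on whose frontier the
kernel is bounded below. -/
theorem norm_dividedDiff_le {m : ℕ} {μ : Fin m → ℂ} (hμ : Function.Injective μ)
    {b q : ℂ → ℂ → ℂ} {U : Set ℂ} (hU : Bornology.IsBounded U) (hμU : ∀ i, μ i ∈ U)
    (hq : ∀ i, Differentiable ℂ (q (μ i)))
    (hb : ∀ i z, b (μ i) z = (z - μ i) / q (μ i) z)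
    {c : ℝ} (hc : 0 < c) (hfr : ∀ i, ∀ z ∈ frontier U, c ≤ ‖b (μ i) z‖)
    {F : ℂ → ℂ} (hF : Differentiable ℂ F) {M : ℝ} (hM : ∀ z ∈ closure U, ‖F z‖ ≤ M)
    (k : ℕ) (i : Fin m) (hki : k ≤ i) :
    ‖dividedDiff b μ (fun i => F (μ i)) k i‖ ≤ (2 / c) ^ k * M := by
  -- The induction carries one entire function interpolating the `k`-th differences at all remaining
  -- nodes, since the maximum principle needs a function and not just its nodal values.
  have key : ∀ k : ℕ, k < m → ∃ G : ℂ → ℂ, Differentiable ℂ G ∧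
      (∀ z ∈ closure U, ‖G z‖ ≤ (2 / c) ^ k * M) ∧
      ∀ i : Fin m, k ≤ i → dividedDiff b μ (fun i => F (μ i)) k i = G (μ i) := by
    intro k
    induction k with
    | zero => exact fun _ => ⟨F, hF, by simpa using hM, fun i _ => rfl⟩
    | succ k ih =>
      intro hk
      obtain ⟨G, hG, hGM, hGd⟩ := ih (by omega)
      have hkm : k < m := by omega
      set ν := μ ⟨k, hkm⟩ with hν
      have hd : Differentiable ℂ fun z => dslope G ν z * q ν z := by
        have : Differentiable ℂ (dslope G ν) := by
          rw [← differentiableOn_univ, Complex.differentiableOn_dslope Filter.univ_mem]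
          exact hG.differentiableOn
        exact this.mul (hq _)
      -- This also holds at zeros of `q ν`, where both sides are `0` because division by zero gives
      -- `0`.
      have hval : ∀ z, z ≠ ν → dslope G ν z * q ν z = (G z - G ν) / b ν z := by
        intro z hz
        have hz' : z - ν ≠ 0 := sub_ne_zero.2 hz
        rw [dslope_of_ne _ hz, slope_def_field, hb, div_div_eq_mul_div, mul_div_right_comm]
      refine ⟨_, hd, ?_, ?_⟩
      · intro z hz
        refine Complex.norm_le_of_forall_mem_frontier_norm_le hU hd.diffContOnCl ?_ hz
        intro w hw
        have hcw := hfr ⟨k, hkm⟩ w hw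
        have hwν : w ≠ ν := by
          rintro rfl
          rw [hb, sub_self, zero_div, norm_zero] at hcw
          linarith
        rw [hval w hwν, norm_div, div_le_iff₀ (hc.trans_le hcw)]
        have h1 := hGM w (frontier_subset_closure hw)
        have h2 := hGM ν (subset_closure (hμU _))
        have h0 : 0 ≤ (2 / c) ^ k * M := (norm_nonneg _).trans h1
        calc ‖G w - G ν‖ ≤ (2 / c) ^ k * M + (2 / c) ^ k * M :=
              (norm_sub_le _ _).trans (add_le_add h1 h2)
          _ = (2 / c) ^ (k + 1) * M * c := by rw [pow_succ]; field_simp; ring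
          _ ≤ _ := by
            refine mul_le_mul_of_nonneg_left hcw ?_
            rw [pow_succ, mul_right_comm]
            positivity
      · intro i hi
        have hne : μ i ≠ ν := by
          intro h
          have := congrArg Fin.val (hμ h)
          simp only at this
          omega
        rw [hval _ hne, dividedDiff, dif_pos hkm, hGd i (by omega), hGd ⟨k, hkm⟩ le_rfl]
  obtain ⟨G, -, hGM, hGd⟩ := key k (by omega)
  rw [hGd i hki]
  exact hGM _ (subset_closure (hμU i))

/-! ### Growth of sine and of the exponential factors -/

theorem norm_exp_I_mul (τ : ℝ) (z : ℂ) :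
    ‖Complex.exp (Complex.I * τ * z)‖ = Real.exp (-(τ * z.im)) := by
  rw [Complex.norm_exp]; simp

theorem norm_exp_neg_I_mul (τ : ℝ) (z : ℂ) :
    ‖Complex.exp (-Complex.I * τ * z)‖ = Real.exp (τ * z.im) := by
  rw [Complex.norm_exp]; simp

theorem norm_sin_le_exp_abs_im (w : ℂ) : ‖Complex.sin w‖ ≤ Real.exp |w.im| := by
  have h1 : ‖Complex.exp (-w * Complex.I)‖ ≤ Real.exp |w.im| := by
    rw [Complex.norm_exp]; simpa using le_abs_self _
  have h2 : ‖Complex.exp (w * Complex.I)‖ ≤ Real.exp |w.im| := by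
    rw [Complex.norm_exp]; simpa using neg_le_abs _
  rw [Complex.sin, norm_div, norm_mul, Complex.norm_I, mul_one, Complex.norm_ofNat]
  linarith [norm_sub_le (Complex.exp (-w * Complex.I)) (Complex.exp (w * Complex.I))]

/-- Euler's formula for whichever of `e^{iw}`, `e^{-iw}` has modulus `e^{|Im w|}`. -/
theorem exp_abs_im_le_norm_sin_add_norm_cos (w : ℂ) :
    Real.exp |w.im| ≤ ‖Complex.sin w‖ + ‖Complex.cos w‖ := by
  rcases abs_cases w.im with ⟨h, -⟩ | ⟨h, -⟩ <;> rw [h]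
  · have : Real.exp w.im = ‖Complex.exp (-w * Complex.I)‖ := by rw [Complex.norm_exp]; simp
    rw [this, Complex.exp_mul_I, Complex.cos_neg, Complex.sin_neg, add_comm ‖_‖]
    refine (norm_add_le _ _).trans_eq ?_
    simp
  · have : Real.exp (-w.im) = ‖Complex.exp (w * Complex.I)‖ := by rw [Complex.norm_exp]; simp
    rw [this, Complex.exp_mul_I, add_comm ‖_‖]
    refine (norm_add_le _ _).trans_eq ?_
    simp

theorem exp_neg_le_norm_expFactor {τ : ℝ} (hτ : 0 < τ) (s : Finset ℂ) (z : ℂ) :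
    Real.exp (-(τ * |z.im|)) ≤ ‖expFactor τ s z‖ := by
  unfold expFactor
  split_ifs
  · rw [norm_exp_I_mul, Real.exp_le_exp]
    nlinarith [le_abs_self z.im]
  · rw [norm_exp_neg_I_mul, Real.exp_le_exp]
    nlinarith [neg_abs_le z.im]

theorem norm_expFactor_le {τ : ℝ} (hτ : 0 < τ) (s : Finset ℂ) (z : ℂ) :
    ‖expFactor τ s z‖ ≤ Real.exp (τ * |z.im|) := by
  unfold expFactor
  split_ifs
  · rw [norm_exp_I_mul, Real.exp_le_exp]
    nlinarith [neg_abs_le z.im]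
  · rw [norm_exp_neg_I_mul, Real.exp_le_exp]
    nlinarith [le_abs_self z.im]

theorem differentiable_expFactor (τ : ℝ) (s : Finset ℂ) : Differentiable ℂ (expFactor τ s) := by
  unfold expFactor
  split_ifs <;> fun_prop

/-! ### Test functions and translations in the Paley–Wiener space -/

/-- The entire function `sin (a z) / z`. -/
noncomputable def sincScaled (a : ℝ) : ℂ → ℂ := dslope (fun z => Complex.sin (a * z)) 0

theorem differentiable_sincScaled (a : ℝ) : Differentiable ℂ (sincScaled a) := by
  rw [← differentiableOn_univ, sincScaled, Complex.differentiableOn_dslope Filter.univ_mem]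
  fun_prop

theorem sincScaled_mul_self (a : ℝ) (w : ℂ) : sincScaled a w * w = Complex.sin (a * w) := by
  have := sub_smul_dslope (fun z : ℂ => Complex.sin (a * z)) 0 w
  simpa [sincScaled, mul_comm] using this

theorem norm_sincScaled_mul_le {a : ℝ} (ha : 0 < a) (w : ℂ) :
    ‖sincScaled a w‖ * ‖w‖ ≤ Real.exp (a * |w.im|) := by
  rw [← norm_mul, sincScaled_mul_self]
  refine (norm_sin_le_exp_abs_im _).trans_eq ?_
  simp [abs_mul, abs_of_pos ha]

theorem exists_norm_sincScaled_le {a : ℝ} (ha : 0 < a) :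
    ∃ C, 0 < C ∧ ∀ w, ‖sincScaled a w‖ * (1 + ‖w‖) ≤ C * Real.exp (a * |w.im|) := by
  obtain ⟨C, hC⟩ := (isCompact_closedBall (0 : ℂ) 1).exists_bound_of_continuousOn
    (differentiable_sincScaled a).continuous.continuousOn
  have hC0 : 0 ≤ C := (norm_nonneg _).trans (hC 0 (by simp))
  refine ⟨2 * C + 2, by positivity, fun w => ?_⟩
  have he : 1 ≤ Real.exp (a * |w.im|) := Real.one_le_exp (by positivity)
  rcases le_total ‖w‖ 1 with h | h
  · have := hC w (by simpa using h)
    nlinarith [norm_nonneg (sincScaled a w), norm_nonneg w]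
  · have := norm_sincScaled_mul_le ha w
    nlinarith [norm_nonneg (sincScaled a w), norm_nonneg w]

/-- On the real line the bound reads `C/(1+|x|)`, whose `p`-th power is integrable exactly because
`p > 1`. -/
theorem mem_PW_of_norm_le {τ p : ℝ} (hτ : 0 < τ) (hp : 1 < p) {f : ℂ → ℂ}
    (hf : Differentiable ℂ f) {C : ℝ} (hC : 0 ≤ C)
    (hb : ∀ w, ‖f w‖ * (1 + ‖w‖) ≤ C * Real.exp (τ * |w.im|)) : f ∈ PW τ p := by
  refine ⟨hf, fun η hη => ⟨C, fun z => ?_⟩, ?_⟩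
  · have h1 : ‖f z‖ ≤ ‖f z‖ * (1 + ‖z‖) := by nlinarith [norm_nonneg (f z), norm_nonneg z]
    refine (h1.trans (hb z)).trans (mul_le_mul_of_nonneg_left (Real.exp_le_exp.2 ?_) hC)
    exact mul_le_mul (by linarith) (Complex.abs_im_le_norm z) (abs_nonneg _) (by linarith)
  · have hi : MeasureTheory.Integrable fun x : ℝ => C ^ p * (1 + ‖x‖) ^ (-p) :=
      (integrable_one_add_norm (by simpa using hp)).const_mul _
    refine hi.mono' ?_ (Filter.Eventually.of_forall fun x => ?_)
    · refine Continuous.aestronglyMeasurable ?_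
      exact ((hf.continuous.comp Complex.continuous_ofReal).norm).rpow_const
        fun _ => Or.inr (by linarith)
    · have h := hb x
      simp only [Complex.ofReal_im, abs_zero, mul_zero, Real.exp_zero, mul_one,
        Complex.norm_real] at h
      have hx : 0 < 1 + ‖x‖ := by positivity
      rw [Real.norm_of_nonneg (by positivity), Real.rpow_neg hx.le, ← div_eq_mul_inv,
        ← Real.div_rpow hC hx.le]
      exact Real.rpow_le_rpow (norm_nonneg _) ((le_div_iff₀ hx).2 h) (by linarith)

theorem comp_sub_mem_PW {τ p : ℝ} (hτ : 0 < τ) {f : ℂ → ℂ} (hf : f ∈ PW τ p) (x : ℝ) :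
    (fun z => f (z - x)) ∈ PW τ p := by
  obtain ⟨hd, ht, hi⟩ := hf
  refine ⟨hd.comp (differentiable_id.sub_const _), fun η hη => ?_, ?_⟩
  · obtain ⟨C, hC⟩ := ht η hη
    have hC0 : 0 ≤ C := by simpa using (norm_nonneg _).trans (hC 0)
    refine ⟨C * Real.exp ((τ + η) * ‖(x : ℂ)‖), fun z => (hC _).trans ?_⟩
    rw [mul_assoc, ← Real.exp_add, ← mul_add]
    gcongr
    rw [add_comm]
    exact norm_sub_le _ _
  · simpa using hi.comp_sub_right x

theorem normPW_comp_sub (p : ℝ) (f : ℂ → ℂ) (x : ℝ) :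
    normPW p (fun z => f (z - x)) = normPW p f := by
  have := MeasureTheory.integral_sub_right_eq_self (μ := MeasureTheory.volume)
    (fun t : ℝ => ‖f (t : ℂ)‖ ^ p) x
  simp only [Complex.ofReal_sub] at this
  rw [normPW, normPW, this]

theorem normPW_pos {τ p : ℝ} (hp : 1 < p) {f : ℂ → ℂ} (hf : f ∈ PW τ p) {x : ℝ}
    (hx : f x ≠ 0) : 0 < normPW p f := by
  refine Real.rpow_pos_of_pos ?_ _
  refine MeasureTheory.integral_pos_of_integrable_nonneg_nonzero (x := x) ?_ hf.2.2
    (fun _ => by positivity) ?_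
  · exact ((hf.1.continuous.comp Complex.continuous_ofReal).norm).rpow_const
        fun _ => Or.inr (by linarith)
  · exact (Real.rpow_pos_of_pos (norm_pos_iff.2 hx) _).ne'

theorem normPW_nonneg (p : ℝ) (f : ℂ → ℂ) : 0 ≤ normPW p f :=
  Real.rpow_nonneg (MeasureTheory.integral_nonneg fun _ => by positivity) _

end PaleyWiener

/-! ### Divided differences of quadratically decaying functions on a single block -/

namespace PaleyWiener

theorem blaschke_zero (μ z : ℂ) : blaschke 0 μ z = (z - μ) / (z - (starRingEnd ℂ) μ) := by
  simp [blaschke]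

theorem sub_conj_ne_zero {σ : ℝ} {z w : ℂ} (hz : 0 < σ * z.im) (hw : 0 < σ * w.im) :
    z - (starRingEnd ℂ) w ≠ 0 := by
  intro h
  have := congrArg Complex.im h
  simp only [Complex.sub_im, Complex.conj_im, sub_neg_eq_add, Complex.zero_im] at this
  have h2 : σ * z.im + σ * w.im = 0 := by rw [← mul_add, this, mul_zero]
  linarith

theorem norm_sub_conj_le (z w : ℂ) : ‖z - (starRingEnd ℂ) w‖ ≤ ‖z - w‖ + 2 * |w.im| := by
  have h : ‖w - (starRingEnd ℂ) w‖ = 2 * |w.im| := by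
    rw [Complex.sub_conj]
    simp
  rw [← h, ← sub_add_sub_cancel z w]
  exact norm_add_le _ _

/-- Pseudohyperbolically close points are close relative to their distance to the real line. -/
theorem norm_sub_le_of_rho_le {σ r : ℝ} (hr0 : 0 ≤ r) (hr : r < 1) {z w : ℂ}
    (hz : 0 < σ * z.im) (hw : 0 < σ * w.im) (h : rho 0 z w ≤ r) :
    ‖z - w‖ ≤ 2 * r / (1 - r) * |w.im| := by
  rw [rho, blaschke_zero, norm_div, div_le_iff₀ (norm_pos_iff.2 (sub_conj_ne_zero hz hw))] at h
  have h1 : 0 < 1 - r := by linarith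
  rw [div_mul_eq_mul_div, le_div_iff₀ h1]
  nlinarith [norm_sub_conj_le z w]

/-- The maximum principle is applied on a region whose size is comparable to the height of the
block, so every constant is scale invariant and depends only on `A` and the order. The sign `σ`
selects the half-plane. -/
theorem norm_dividedDiff_blaschke_le {σ A : ℝ} (hσ : |σ| = 1) (hA : 0 ≤ A) {s : Set ℂ}
    (hs : ∀ z ∈ s, 0 < σ * z.im) (hd : ∀ z ∈ s, ∀ w ∈ s, ‖z - w‖ ≤ A * |w.im|)
    {x : ℝ} {F : ℂ → ℂ} (hF : Differentiable ℂ F)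
    (hFx : ∀ z : ℂ, 0 < σ * z.im → ‖F z‖ * ‖z - x‖ ^ 2 ≤ 1)
    {m : ℕ} {μ : Fin m → ℂ} (hμ : Function.Injective μ) (hμs : ∀ i, μ i ∈ s)
    {l : ℂ} (hl : l ∈ s) (k : Fin m) :
    ‖dividedDiff (blaschke 0) μ (fun i => F (μ i)) k k‖ * ‖l - x‖ ^ 2 ≤
      (2 * (1 + 4 * (1 + A) ^ 2)) ^ (k : ℕ) * (1 + 2 * (1 + A) ^ 2) ^ 2 := by
  have habs : ∀ z : ℂ, σ * z.im ≤ |z.im| := fun z => by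
    simpa [abs_mul, hσ] using le_abs_self (σ * z.im)
  have habs' : ∀ z ∈ s, |z.im| = σ * z.im := fun z hz => by
    rw [← abs_of_pos (hs z hz), abs_mul, hσ, one_mul]
  set B := 1 + A with hB
  have hB1 : 1 ≤ B := by linarith
  set y := σ * l.im with hy
  have hy0 : 0 < y := hs l hl
  have hlx : 0 < ‖l - x‖ := by
    refine hy0.trans_le ((habs l).trans ?_)
    simpa using Complex.abs_im_le_norm (l - x)
  -- Block points have height at least `y/B = 2κ`, so the line at height `κ` clears both the nodes
  -- and the real axis by at least `κ`.
  set κ := y / (2 * B) with hκ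
  have hκ0 : 0 < κ := by positivity
  have hκB : 2 * B * κ = y := by rw [hκ]; field_simp
  have hκy : κ ≤ y := by nlinarith
  set U : Set ℂ := {z | κ < σ * z.im} ∩ Metric.ball l (B * y) with hU
  have hopen : IsOpen U :=
    (isOpen_lt continuous_const (by fun_prop)).inter Metric.isOpen_ball
  have hcl : closure U ⊆ {z | κ ≤ σ * z.im} ∩ Metric.closedBall l (B * y) := by
    refine closure_minimal ?_
      ((isClosed_le continuous_const (by fun_prop)).inter Metric.isClosed_closedBall)
    exact fun z hz => ⟨Set.mem_ofPred.2 (le_of_lt hz.1), Metric.ball_subset_closedBall hz.2⟩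
  have hlow : ∀ z ∈ s, 2 * κ ≤ σ * z.im := by
    intro z hz
    have h1 := hd l hl z hz
    have h2 := (habs (l - z)).trans (Complex.abs_im_le_norm (l - z))
    rw [habs' z hz] at h1
    rw [Complex.sub_im, mul_sub, ← hy] at h2
    have : y ≤ B * (σ * z.im) := by rw [hB]; linarith
    rw [← hκB] at this
    nlinarith
  have hup : ∀ z ∈ s, |z.im| ≤ B * y := by
    intro z hz
    have h1 := hd z hz l hl
    have h2 := (habs (z - l)).trans (Complex.abs_im_le_norm (z - l))
    rw [habs' l hl, ← hy] at h1
    rw [Complex.sub_im, mul_sub, ← hy] at h2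
    rw [habs' z hz, hB]
    linarith
  have hbound := norm_dividedDiff_le (b := blaschke 0)
    (q := fun w z => z - (starRingEnd ℂ) w) (c := 1 / (1 + 4 * B ^ 2))
    (M := (1 + 2 * B ^ 2) ^ 2 / ‖l - x‖ ^ 2) hμ
    (Metric.isBounded_ball.subset (Set.inter_subset_right : U ⊆ _)) ?_
    (fun i => by fun_prop) (fun i z => blaschke_zero _ _) (by positivity) ?_ hF ?_
    k k le_rfl
  · rw [div_div_eq_mul_div, div_one, mul_div_assoc', le_div_iff₀ (by positivity)] at hbound
    exact hbound
  · intro i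
    refine ⟨?_, ?_⟩
    · have := hlow _ (hμs i)
      exact Set.mem_ofPred.2 (by linarith)
    · rw [Metric.mem_ball, dist_eq_norm]
      have := hd _ (hμs i) l hl
      rw [habs' l hl, ← hy] at this
      nlinarith
  · intro i z hz
    have hzc := hcl (frontier_subset_closure hz)
    have hzU : z ∉ U := by
      rw [frontier, hopen.interior_eq] at hz
      exact hz.2
    have hz0 : 0 < σ * z.im := hκ0.trans_le hzc.1
    -- A frontier point lies either on the sphere, at least `By - Ay = y` from the nodes, or at
    -- height `κ`, below all nodes.
    have hsep : κ ≤ ‖z - μ i‖ := by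
      by_cases h : κ < σ * z.im
      · have h3 : B * y ≤ ‖z - l‖ := by
          by_contra! h4
          exact hzU ⟨h, by rwa [Metric.mem_ball, dist_eq_norm]⟩
        have h4 := hd _ (hμs i) l hl
        rw [habs' l hl, ← hy] at h4
        have h5 := norm_sub_le_norm_sub_add_norm_sub z (μ i) l
        nlinarith
      · have h2 := (habs (μ i - z)).trans (Complex.abs_im_le_norm (μ i - z))
        rw [Complex.sub_im, mul_sub, norm_sub_rev] at h2
        linarith [hlow _ (hμs i)]
    rw [blaschke_zero, norm_div,
      le_div_iff₀ (norm_pos_iff.2 (sub_conj_ne_zero hz0 (hs _ (hμs i)))), one_div_mul_eq_div,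
      div_le_iff₀ (by positivity)]
    have h6 := norm_sub_conj_le z (μ i)
    have h7 := hup _ (hμs i)
    rw [← hκB] at h7
    nlinarith [mul_le_mul_of_nonneg_left hsep (sq_nonneg B)]
  · intro z hz
    have hzc := hcl hz
    have hz1 : κ ≤ σ * z.im := hzc.1
    have hzx : κ ≤ ‖z - x‖ := by
      refine hz1.trans ((habs z).trans ?_)
      simpa using Complex.abs_im_le_norm (z - x)
    -- The radius is `By = 2B²κ`, and `κ ≤ |z-x|`: moving across the region changes the distance to
    -- `x` by a bounded factor.
    have hlz : ‖l - x‖ ≤ (1 + 2 * B ^ 2) * ‖z - x‖ := by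
      have h1 := hzc.2
      rw [Metric.mem_closedBall, dist_eq_norm, norm_sub_rev, ← hκB] at h1
      have h2 := norm_sub_le_norm_sub_add_norm_sub l z x
      nlinarith [mul_le_mul_of_nonneg_left hzx (sq_nonneg B)]
    rw [le_div_iff₀ (by positivity)]
    calc ‖F z‖ * ‖l - x‖ ^ 2 ≤ ‖F z‖ * ((1 + 2 * B ^ 2) * ‖z - x‖) ^ 2 := by gcongr
      _ = (1 + 2 * B ^ 2) ^ 2 * (‖F z‖ * ‖z - x‖ ^ 2) := by ring
      _ ≤ (1 + 2 * B ^ 2) ^ 2 * 1 := by gcongr; exact hFx z (hκ0.trans_le hz1)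
      _ = _ := mul_one _

/-- The maximum principle on the ball of radius `d + 1` about `l`: its boundary is at distance at
least `1` from the nodes, and distances to `x` vary by a factor at most `2` on it. -/
theorem norm_dividedDiff_sub_le {d E : ℝ} (hd0 : 0 ≤ d) {s : Set ℂ}
    (hd : ∀ z ∈ s, ∀ w ∈ s, dist z w ≤ d)
    {x : ℝ} {F : ℂ → ℂ} (hF : Differentiable ℂ F) {l : ℂ} (hl : l ∈ s)
    (hFx : ∀ z : ℂ, dist z l ≤ d + 1 → ‖F z‖ * ‖z - x‖ ^ 2 ≤ E)
    {m : ℕ} {μ : Fin m → ℂ} (hμ : Function.Injective μ) (hμs : ∀ i, μ i ∈ s)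
    (hlx : 2 * (d + 1) ≤ ‖l - x‖) (k : Fin m) :
    ‖dividedDiff (fun w z => z - w) μ (fun i => F (μ i)) k k‖ * ‖l - x‖ ^ 2 ≤
      2 ^ (k : ℕ) * (4 * E) := by
  have hlx0 : 0 < ‖l - x‖ := by linarith
  have hbound := norm_dividedDiff_le (b := fun w z => z - w) (q := fun _ _ => 1) (c := 1)
    (M := 4 * E / ‖l - x‖ ^ 2) hμ (Metric.isBounded_ball (x := l) (r := d + 1)) ?_
    (fun i => by fun_prop) (fun i z => (div_one _).symm) one_pos ?_ hF ?_ k k le_rfl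
  · rwa [div_one, mul_div_assoc', le_div_iff₀ (by positivity)] at hbound
  · exact fun i => Metric.mem_ball.2 ((hd _ (hμs i) _ hl).trans_lt (by linarith))
  · intro i z hz
    have h1 : dist z l = d + 1 := Metric.frontier_ball_subset_sphere hz
    rw [← dist_eq_norm]
    linarith [dist_triangle z (μ i) l, hd _ (hμs i) _ hl]
  · intro z hz
    have h1 : dist z l ≤ d + 1 := Metric.closure_ball_subset_closedBall hz
    have h2 : ‖l - x‖ ≤ 2 * ‖z - x‖ := by
      have := norm_sub_le_norm_sub_add_norm_sub l z x
      rw [norm_sub_rev l z, ← dist_eq_norm z l] at this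
      linarith
    rw [le_div_iff₀ (by positivity)]
    calc ‖F z‖ * ‖l - x‖ ^ 2 ≤ ‖F z‖ * (2 * ‖z - x‖) ^ 2 := by gcongr
      _ = 4 * (‖F z‖ * ‖z - x‖ ^ 2) := by ring
      _ ≤ 4 * E := by gcongr; exact hFx z h1

/-! ### Geometry of adapted partitions and uniform bounds over all blocks -/

namespace AdaptedPartition

variable {N : ℕ} {ε : ℝ} {Λ : Set ℂ}

theorem nonempty_of_mem_blocks (P : AdaptedPartition N ε Λ) {s : Finset ℂ} (hs : s ∈ P.blocks) :
    s.Nonempty := by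
  rcases hs with ⟨h | h, -⟩ | h
  · exact P.upper_partition.nonempty s h
  · exact P.lower_partition.nonempty s h
  · exact P.near_partition.nonempty s h

theorem card_le_of_mem_blocks (P : AdaptedPartition N ε Λ) {s : Finset ℂ} (hs : s ∈ P.blocks) :
    s.card ≤ N := by
  rcases hs with ⟨h | h, -⟩ | h
  · exact P.upper_partition.card_le s h
  · exact P.lower_partition.card_le s h
  · exact P.near_partition.card_le s h

theorem mem_of_mem_blocks (P : AdaptedPartition N ε Λ) {s : Finset ℂ} (hs : s ∈ P.blocks)
    {z : ℂ} (hz : z ∈ s) : z ∈ Λ := by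
  rcases hs with ⟨h | h, -⟩ | h
  · exact (P.upper_partition.union.subset (Set.mem_biUnion h hz)).1
  · exact (P.lower_partition.union.subset (Set.mem_biUnion h hz)).1
  · exact (P.near_partition.union.subset (Set.mem_biUnion h hz)).1

theorem im_pos_of_mem_upper (P : AdaptedPartition N ε Λ) {s : Finset ℂ} (hs : s ∈ P.upper)
    {z : ℂ} (hz : z ∈ s) : 0 < z.im :=
  (P.upper_partition.union.subset (Set.mem_biUnion hs hz)).2

theorem im_neg_of_mem_lower (P : AdaptedPartition N ε Λ) {s : Finset ℂ} (hs : s ∈ P.lower)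
    {z : ℂ} (hz : z ∈ s) : z.im < 0 :=
  (P.lower_partition.union.subset (Set.mem_biUnion hs hz)).2

/-- The blocks in the two half-planes have a diameter comparable to the distance to the real
line. -/
theorem exists_norm_sub_le (P : AdaptedPartition N ε Λ) : ∃ A : ℝ, 0 ≤ A ∧
    ∀ s ∈ P.upper ∪ P.lower, ∀ z ∈ s, ∀ w ∈ s, ‖z - w‖ ≤ A * |w.im| := by
  obtain ⟨r, -, hr1, hr⟩ := P.rho_diam
  -- With no blocks at all, the bound `r` may be negative, hence the truncation.
  have h0 : 0 ≤ max r 0 := le_max_right _ _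
  have h1 : max r 0 < 1 := max_lt hr1 one_pos
  have h2 : 0 < 1 - max r 0 := by linarith
  refine ⟨2 * max r 0 / (1 - max r 0), by positivity, fun s hs z hz w hw => ?_⟩
  have hρ := (hr s hs z hz w hw).trans (le_max_left r 0)
  rcases hs with h | h
  · have hU := fun v (hv : v ∈ s) => P.im_pos_of_mem_upper h hv
    exact norm_sub_le_of_rho_le (σ := 1) h0 h1 (by simpa using hU z hz) (by simpa using hU w hw) hρ
  · have hU := fun v (hv : v ∈ s) => P.im_neg_of_mem_lower h hv
    exact norm_sub_le_of_rho_le (σ := -1) h0 h1 (by simpa using hU z hz) (by simpa using hU w hw) hρ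

/-- A non-real point is regrouped only if its original block meets the strip; that block has
diameter at most `A * ε`, by comparison with its point in the strip. -/
theorem exists_abs_im_le_of_mem_near (P : AdaptedPartition N ε Λ) (hε : 0 < ε) : ∃ H : ℝ, 0 ≤ H ∧
    ∀ s ∈ P.near, ∀ z ∈ s, |z.im| ≤ H := by
  obtain ⟨A, hA, hd⟩ := P.exists_norm_sub_le
  refine ⟨(A + 1) * ε, by positivity, fun s hs z hz => ?_⟩
  obtain ⟨hzΛ, hfar⟩ := P.near_partition.union.subset (Set.mem_biUnion hs hz)
  by_cases hz0 : z.im = 0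
  · rw [hz0, abs_zero]
    positivity
  obtain ⟨t, ht, hzt⟩ : ∃ t ∈ P.upper ∪ P.lower, z ∈ t := by
    rcases lt_or_gt_of_ne hz0 with h | h
    · have : z ∈ Λ ∩ lowerHP 0 := ⟨hzΛ, h⟩
      rw [← P.lower_partition.union] at this
      obtain ⟨t, ht, hzt⟩ := Set.mem_iUnion₂.1 this
      exact ⟨t, Or.inr ht, hzt⟩
    · have : z ∈ Λ ∩ upperHP 0 := ⟨hzΛ, h⟩
      rw [← P.upper_partition.union] at this
      obtain ⟨t, ht, hzt⟩ := Set.mem_iUnion₂.1 this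
      exact ⟨t, Or.inl ht, hzt⟩
  obtain ⟨w, hw, hwε⟩ : ∃ w ∈ t, |w.im| < ε := by
    by_contra! h
    exact hfar (Set.mem_biUnion (show t ∈ farBlocks ε (P.upper ∪ P.lower) from ⟨ht, h⟩) hzt)
  have h1 := hd t ht z hzt w hw
  have h2 := Complex.abs_im_le_norm (z - w)
  rw [Complex.sub_im] at h2
  have h3 := abs_sub_abs_le_abs_sub z.im w.im
  nlinarith

theorem blockDiff_restriction (P : AdaptedPartition N ε Λ) (τ : ℝ) (f : ℂ → ℂ) {s : Finset ℂ}
    (hs : s ∈ P.blocks) (k : Fin s.card) :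
    P.blockDiff τ (restriction Λ f) s k = dividedDiff (P.kernel s) (fun i => (P.node s i : ℂ))
      (fun i => f (P.node s i) * expFactor τ s (P.node s i)) k k := by
  rw [blockDiff]
  congr 1
  funext i
  rw [extendZero, dif_pos (P.mem_of_mem_blocks hs (P.node s i).2)]
  rfl

/-- Divided differences of a function that decays quadratically away from a real point. -/
theorem exists_norm_blockDiff_mul_le (P : AdaptedPartition N ε Λ) (hε : 0 < ε) {τ : ℝ}
    (hτ : 0 < τ) : ∃ K R : ℝ, 0 < K ∧ ∀ (x : ℝ) (f : ℂ → ℂ), Differentiable ℂ f →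
      (∀ z, ‖f z‖ * ‖z - x‖ ^ 2 ≤ Real.exp (τ * |z.im|)) →
      ∀ s ∈ P.blocks, ∀ l ∈ s, R ≤ ‖l - x‖ → ∀ k,
        ‖P.blockDiff τ (restriction Λ f) s k‖ * ‖l - x‖ ^ 2 ≤ K := by
  obtain ⟨A, hA, hA'⟩ := P.exists_norm_sub_le
  obtain ⟨H, hH, hH'⟩ := P.exists_abs_im_le_of_mem_near hε
  obtain ⟨d, hd, hd'⟩ := P.near_diam
  -- A near block may straddle the real axis, so its exponential factor need not cancel the growth
  -- of `f`; both are bounded by `e^{τ|Im z|}` at bounded height.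
  set E := Real.exp (2 * τ * (H + ε + 1)) with hE
  set K₁ := (2 * (1 + 4 * (1 + A) ^ 2)) ^ N * (1 + 2 * (1 + A) ^ 2) ^ 2 with hK₁
  set K₂ := 2 ^ N * (4 * E) with hK₂
  refine ⟨K₁ + K₂, 2 * (ε + 1), by positivity, fun x f hf hfx s hs l hl hlx k => ?_⟩
  have hk : (k : ℕ) ≤ N := k.2.le.trans (P.card_le_of_mem_blocks hs)
  have hinj : Function.Injective fun i => (P.node s i : ℂ) :=
    Subtype.val_injective.comp (P.node s).injective
  have hmem : ∀ i, (P.node s i : ℂ) ∈ (s : Set ℂ) := fun i => (P.node s i).2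
  have hF : Differentiable ℂ fun z => f z * expFactor τ s z := hf.mul (differentiable_expFactor τ s)
  rw [P.blockDiff_restriction τ f hs]
  by_cases hn : s ∈ P.near
  · rw [kernel, if_pos hn]
    have hbound := norm_dividedDiff_sub_le (s := (s : Set ℂ)) (E := E) (x := x) hε.le
      (fun z hz w hw => (hd' s hn z hz w hw).trans (by linarith)) hF hl ?_ hinj hmem hlx k
    · refine hbound.trans (le_trans ?_ (le_add_of_nonneg_left (by positivity)))
      rw [hK₂]
      gcongr
      exact one_le_two
    · intro z hz
      have h1 : |z.im| ≤ H + ε + 1 := by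
        have h2 := Complex.abs_im_le_norm (z - l)
        rw [Complex.sub_im, ← dist_eq_norm] at h2
        linarith [abs_sub_abs_le_abs_sub z.im l.im, hH' s hn l hl]
      calc ‖f z * expFactor τ s z‖ * ‖z - x‖ ^ 2
          = (‖f z‖ * ‖z - x‖ ^ 2) * ‖expFactor τ s z‖ := by rw [norm_mul]; ring
        _ ≤ Real.exp (τ * |z.im|) * Real.exp (τ * |z.im|) :=
          mul_le_mul (hfx z) (norm_expFactor_le hτ s z) (norm_nonneg _) (Real.exp_pos _).le
        _ ≤ E := by
          rw [hE, ← Real.exp_add, Real.exp_le_exp]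
          nlinarith
  · rw [kernel, if_neg hn]
    have hs' : s ∈ P.upper ∪ P.lower := by
      rcases hs with h | h
      · exact h.1
      · exact absurd h hn
    -- A kept block lies in one half-plane, where its exponential factor cancels the growth of `f`
    -- exactly, uniformly in the height.
    obtain ⟨σ, hσ, hsσ, heσ⟩ : ∃ σ : ℝ, |σ| = 1 ∧ (∀ z ∈ (s : Set ℂ), 0 < σ * z.im) ∧
        ∀ z : ℂ, 0 < σ * z.im → ‖expFactor τ s z‖ = Real.exp (-(τ * |z.im|)) := by
      rcases hs' with h | h
      · have hU := fun v (hv : v ∈ s) => P.im_pos_of_mem_upper h hv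
        refine ⟨1, by simp, fun z hz => by simpa using hU z hz, fun z hz => ?_⟩
        rw [expFactor, if_pos ⟨l, hl, (hU l hl).le⟩, norm_exp_I_mul, abs_of_pos (by simpa using hz)]
      · have hU := fun v (hv : v ∈ s) => P.im_neg_of_mem_lower h hv
        refine ⟨-1, by simp, fun z hz => by simpa using hU z hz, fun z hz => ?_⟩
        rw [expFactor, if_neg, norm_exp_neg_I_mul, abs_of_neg (by simpa using hz), mul_neg, neg_neg]
        rintro ⟨w, hw, hw0⟩
        exact absurd (hU w hw) (not_lt.2 hw0)
    have hbound := norm_dividedDiff_blaschke_le (s := (s : Set ℂ)) (x := x) hσ hA hsσ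
      (fun z hz w hw => hA' s hs' z hz w hw) hF ?_ hinj hmem hl k
    · refine hbound.trans (le_trans ?_ (le_add_of_nonneg_right (by positivity)))
      rw [hK₁]
      gcongr
      nlinarith
    · intro z hz
      calc ‖f z * expFactor τ s z‖ * ‖z - x‖ ^ 2
          = (‖f z‖ * ‖z - x‖ ^ 2) * ‖expFactor τ s z‖ := by rw [norm_mul]; ring
        _ ≤ Real.exp (τ * |z.im|) * Real.exp (-(τ * |z.im|)) := by
          rw [heσ z hz]
          exact mul_le_mul_of_nonneg_right (hfx z) (Real.exp_pos _).le
        _ = 1 := by rw [← Real.exp_add, add_neg_cancel, Real.exp_zero]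

end AdaptedPartition

end PaleyWiener

/-! ### Comparison of sampled norms far from `Λ` -/

namespace PaleyWiener

theorem add_rpow_le_two_rpow_mul {p u v : ℝ} (hp : 0 ≤ p) (hu : 0 ≤ u) (hv : 0 ≤ v) :
    (u + v) ^ p ≤ 2 ^ p * (u ^ p + v ^ p) := by
  have hu' := Real.rpow_nonneg hu p
  have hv' := Real.rpow_nonneg hv p
  have h2 : (0 : ℝ) ≤ 2 ^ p := by positivity
  rcases le_total u v with h | h
  · calc (u + v) ^ p ≤ (2 * v) ^ p := Real.rpow_le_rpow (by positivity) (by linarith) hp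
      _ = 2 ^ p * v ^ p := Real.mul_rpow two_pos.le hv
      _ ≤ _ := mul_le_mul_of_nonneg_left (by linarith) h2
  · calc (u + v) ^ p ≤ (2 * u) ^ p := Real.rpow_le_rpow (by positivity) (by linarith) hp
      _ = 2 ^ p * u ^ p := Real.mul_rpow two_pos.le hu
      _ ≤ _ := mul_le_mul_of_nonneg_left (by linarith) h2

/-- Two translates of `sin (τ z) / z` are not both small. -/
theorem exp_abs_im_le_norm_sincScaled_add {τ : ℝ} (hτ : 0 < τ) {x : ℝ} {l : ℂ}
    (hl : Real.pi / (2 * τ) ≤ ‖l - x‖) :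
    Real.exp (τ * |l.im|) ≤ 2 * ‖l - x‖ *
      (‖sincScaled τ (l - x)‖ + ‖sincScaled τ (l - (x + Real.pi / (2 * τ) : ℝ))‖) := by
  set x' : ℝ := x + Real.pi / (2 * τ) with hx'
  have h1 := exp_abs_im_le_norm_sin_add_norm_cos (τ * (l - x))
  have him : |((τ : ℂ) * (l - x)).im| = τ * |l.im| := by simp [abs_mul, abs_of_pos hτ]
  -- The shift `π/(2τ)` is a quarter period, turning sine into cosine up to sign.
  have hcos : ‖Complex.cos (τ * (l - x))‖ = ‖Complex.sin (τ * (l - x'))‖ := by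
    have : (τ : ℂ) * (l - x') = τ * (l - x) - Real.pi / 2 := by
      have hτ' : (τ : ℂ) ≠ 0 := by exact_mod_cast hτ.ne'
      rw [hx']
      push_cast
      field_simp
      ring
    rw [this, Complex.sin_sub_pi_div_two, norm_neg]
  rw [him, hcos, ← sincScaled_mul_self, ← sincScaled_mul_self, norm_mul, norm_mul] at h1
  have h2 : ‖l - x'‖ ≤ 2 * ‖l - x‖ := by
    have h3 : l - x' = l - x - (Real.pi / (2 * τ) : ℝ) := by rw [hx']; push_cast; ring
    have h4 := norm_sub_le (l - x) ((Real.pi / (2 * τ) : ℝ) : ℂ)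
    rw [Complex.norm_real, Real.norm_of_nonneg (by positivity)] at h4
    rw [h3]
    linarith
  nlinarith [norm_nonneg (sincScaled τ (l - x)), norm_nonneg (sincScaled τ (l - x')),
    norm_nonneg (l - x)]

namespace AdaptedPartition

variable {N : ℕ} {ε : ℝ} {Λ : Set ℂ}

theorem normPow_le_of_normX_le (P : AdaptedPartition N ε Λ) {τ p : ℝ} (hp : 0 < p) {a : Λ → ℂ}
    (ha : a ∈ P.X τ p) {B : ℝ} (h : P.normX τ p a ≤ B) :
    P.normPow τ p a ≤ ENNReal.ofReal (B ^ p) := by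
  refine (ENNReal.le_ofReal_iff_toReal_le (ne_of_lt ha) ?_).2 ?_
  · exact Real.rpow_nonneg ((Real.rpow_nonneg ENNReal.toReal_nonneg _).trans h) _
  · have h1 := Real.rpow_le_rpow (Real.rpow_nonneg ENNReal.toReal_nonneg _) h hp.le
    rwa [← Real.rpow_mul ENNReal.toReal_nonneg, one_div_mul_cancel hp.ne', Real.rpow_one] at h1

theorem le_normPow_of_le_normX (P : AdaptedPartition N ε Λ) {τ p : ℝ} (hp : 0 < p) {a : Λ → ℂ}
    {B : ℝ} (hB : 0 ≤ B) (h : B ≤ P.normX τ p a) :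
    ENNReal.ofReal (B ^ p) ≤ P.normPow τ p a := by
  refine ENNReal.ofReal_le_of_le_toReal ?_
  have h1 := Real.rpow_le_rpow hB h hp.le
  rwa [normX, ← Real.rpow_mul ENNReal.toReal_nonneg, one_div_mul_cancel hp.ne', Real.rpow_one] at h1

/-- If `Λ` is far from the real point `x`, the norm of a function with quadratic decay away from
`x` is small compared to the norms of two translates of `sin (τ z) / z`. -/
theorem exists_normPow_le (P : AdaptedPartition N ε Λ) (hε : 0 < ε) {τ p : ℝ} (hτ : 0 < τ)
    (hp : 1 < p) : ∃ K R₀ : ℝ, 0 < K ∧ 0 < R₀ ∧ ∀ R, R₀ ≤ R → ∀ x : ℝ,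
      (∀ l ∈ Λ, R ≤ ‖l - x‖) → ∀ f : ℂ → ℂ, Differentiable ℂ f →
      (∀ z, ‖f z‖ * ‖z - x‖ ^ 2 ≤ Real.exp (τ * |z.im|)) →
      P.normPow τ p (restriction Λ f) ≤ ENNReal.ofReal (N * (K / R) ^ p) *
        (P.normPow τ p (restriction Λ fun z => sincScaled τ (z - x)) +
         P.normPow τ p (restriction Λ fun z =>
          sincScaled τ (z - (x + Real.pi / (2 * τ) : ℝ)))) := by
  obtain ⟨K, R₁, hK, hKR⟩ := P.exists_norm_blockDiff_mul_le hε hτ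
  have hp0 : 0 ≤ p := by linarith
  refine ⟨4 * K, max R₁ (Real.pi / (2 * τ)), by positivity,
    lt_max_of_lt_right (by positivity), fun R hR x hΛ f hf hfx => ?_⟩
  have hR0 : 0 < R := lt_of_lt_of_le (lt_max_of_lt_right (by positivity)) hR
  set g : ℂ → ℂ := fun z => sincScaled τ (z - x) with hg
  set g' : ℂ → ℂ := fun z => sincScaled τ (z - (x + Real.pi / (2 * τ) : ℝ)) with hg'
  rw [normPow, normPow, normPow, ← ENNReal.tsum_add, ← ENNReal.tsum_mul_left]
  refine ENNReal.tsum_le_tsum fun ⟨s, hs⟩ => ?_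
  rw [← ENNReal.ofReal_add (by positivity) (by positivity), ← ENNReal.ofReal_mul (by positivity)]
  refine ENNReal.ofReal_le_ofReal ?_
  simp only
  have hcard : 0 < s.card := (P.nonempty_of_mem_blocks hs).card_pos
  -- The zeroth difference is the value at the first node; it alone supplies the lower bound for the
  -- comparison functions.
  set o : Fin s.card := ⟨0, hcard⟩ with ho
  set l : ℂ := (P.node s o : ℂ) with hl
  have hls : l ∈ s := (P.node s o).2
  have hlR : R ≤ ‖l - x‖ := hΛ l (P.mem_of_mem_blocks hs hls)
  have hzero : ∀ h : ℂ → ℂ, P.blockDiff τ (restriction Λ h) s o = h l * expFactor τ s l := by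
    intro h
    rw [P.blockDiff_restriction τ h hs]
    rfl
  set u := ‖P.blockDiff τ (restriction Λ g) s o‖ with hu
  set v := ‖P.blockDiff τ (restriction Λ g') s o‖ with hv
  have huv : 1 ≤ 2 * ‖l - x‖ * (u + v) := by
    have h1 := exp_abs_im_le_norm_sincScaled_add hτ (((le_max_right _ _).trans hR).trans hlR)
    have h2 := exp_neg_le_norm_expFactor hτ s l
    have h3 := mul_le_mul h1 h2 (Real.exp_pos _).le (by positivity)
    rw [← Real.exp_add, add_neg_cancel, Real.exp_zero] at h3
    rw [hu, hv, hzero, hzero, norm_mul, norm_mul]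
    refine h3.trans_eq ?_
    ring
  have hdiff : ∀ k, ‖P.blockDiff τ (restriction Λ f) s k‖ ^ p ≤
      (4 * K / R) ^ p * (u ^ p + v ^ p) := by
    intro k
    have h1 := hKR x f hf hfx s hs l hls (((le_max_left _ _).trans hR).trans hlR) k
    set D := ‖P.blockDiff τ (restriction Λ f) s k‖ with hD
    have hD0 : 0 ≤ D := norm_nonneg _
    have hl0 : 0 < ‖l - x‖ := hR0.trans_le hlR
    have huv0 : 0 ≤ u + v := add_nonneg (norm_nonneg _) (norm_nonneg _)
    have h2 : D ≤ 2 * K / R * (u + v) := by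
      -- Quadratic against linear decay: multiply `K` by `huv`. Cancelling `‖l - x‖` leaves one
      -- further factor, at least `R`.
      have h3 : D * ‖l - x‖ ^ 2 ≤ 2 * K * (u + v) * ‖l - x‖ := by nlinarith
      have h4 : D * ‖l - x‖ ≤ 2 * K * (u + v) := by
        refine le_of_mul_le_mul_right ?_ hl0
        nlinarith
      rw [div_mul_eq_mul_div, le_div_iff₀ hR0]
      nlinarith
    calc D ^ p ≤ (2 * K / R * (u + v)) ^ p := Real.rpow_le_rpow hD0 h2 hp0
      _ = (2 * K / R) ^ p * (u + v) ^ p := Real.mul_rpow (by positivity) huv0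
      _ ≤ (2 * K / R) ^ p * (2 ^ p * (u ^ p + v ^ p)) := by
        gcongr
        exact add_rpow_le_two_rpow_mul hp0 (norm_nonneg _) (norm_nonneg _)
      _ = (2 * K / R * 2) ^ p * (u ^ p + v ^ p) := by
        rw [Real.mul_rpow (by positivity) two_pos.le, mul_assoc]
      _ = _ := by
        congr 2
        ring
  have hsingle : ∀ h : ℂ → ℂ, ‖P.blockDiff τ (restriction Λ h) s o‖ ^ p ≤
      ∑ k, ‖P.blockDiff τ (restriction Λ h) s k‖ ^ p := fun h =>
    Finset.single_le_sum (f := fun k => ‖P.blockDiff τ (restriction Λ h) s k‖ ^ p)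
      (fun _ _ => by positivity) (Finset.mem_univ o)
  have hsum : ∑ k, ‖P.blockDiff τ (restriction Λ f) s k‖ ^ p ≤
      N * (4 * K / R) ^ p * (u ^ p + v ^ p) := by
    refine (Finset.sum_le_card_nsmul _ _ _ fun k _ => hdiff k).trans ?_
    rw [Finset.card_univ, Fintype.card_fin, nsmul_eq_mul, mul_assoc]
    have : (s.card : ℝ) ≤ N := by exact_mod_cast P.card_le_of_mem_blocks hs
    gcongr
  -- The weight `1 + |Im|` is the same on both sides, so it factors out.
  rw [← mul_add, mul_left_comm]
  refine mul_le_mul_of_nonneg_left (hsum.trans ?_) (by positivity)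
  exact mul_le_mul_of_nonneg_left (add_le_add (hsingle g) (hsingle g')) (by positivity)

end AdaptedPartition

end PaleyWiener

/-! ### Conclusion: gaps cannot be arbitrarily long -/

open PaleyWiener in
theorem proposition4 (N : ℕ) (hN : 1 ≤ N) (τ p : ℝ) (hτ : 0 < τ) (hp : 1 < p) (Λ : Set ℂ)
    (hΛ : PaleyWiener.IsNCarlesonInEveryHalfPlane N Λ)
    (hiso : ∃ ε : ℝ, 0 < ε ∧ ∃ P : PaleyWiener.AdaptedPartition N ε Λ,
      PaleyWiener.RestrictionIsIsomorphism P τ p) :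
    PaleyWiener.RelativelyDense Λ := by
  obtain ⟨ε, hε, P, hbij, c, C, hc, hC, hnorm⟩ := hiso
  obtain ⟨K, R₀, hK, hR₀, hpow⟩ := P.exists_normPow_le hε hτ hp
  have hp0 : 0 < p := by linarith
  have hτ2 : 0 < τ / 2 := by linarith
  obtain ⟨C₁, hC₁, hS⟩ := exists_norm_sincScaled_le hτ
  obtain ⟨C₂, hC₂, hT⟩ := exists_norm_sincScaled_le hτ2
  have hexp : ∀ w : ℂ, Real.exp (τ / 2 * |w.im|) ^ 2 = Real.exp (τ * |w.im|) := fun w => by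
    rw [← Real.exp_nat_mul]
    congr 1
    push_cast
    ring
  -- Halving the frequency keeps the square of type `τ` while giving quadratic decay.
  set f : ℂ → ℂ := fun z => sincScaled (τ / 2) z ^ 2 with hf
  have hfd : Differentiable ℂ f := (differentiable_sincScaled _).pow 2
  have hSmem : sincScaled τ ∈ PW τ p :=
    mem_PW_of_norm_le hτ hp (differentiable_sincScaled τ) hC₁.le hS
  have hfmem : f ∈ PW τ p := by
    refine mem_PW_of_norm_le (C := C₂ ^ 2) hτ hp hfd (by positivity) fun w => ?_
    have h1 := pow_le_pow_left₀ (by positivity) (hT w) 2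
    rw [mul_pow, mul_pow, hexp] at h1
    refine le_trans ?_ h1
    rw [hf, norm_pow]
    gcongr
    nlinarith [norm_nonneg w]
  have hf0 : f ((Real.pi / τ : ℝ) : ℂ) ≠ 0 := by
    have h1 := sincScaled_mul_self (τ / 2) ((Real.pi / τ : ℝ) : ℂ)
    have h2 : ((τ / 2 : ℝ) : ℂ) * ((Real.pi / τ : ℝ) : ℂ) = Real.pi / 2 := by
      rw [← Complex.ofReal_mul]
      have : τ / 2 * (Real.pi / τ) = Real.pi / 2 := by field_simp
      rw [this]
      push_cast
      rfl
    rw [h2, Complex.sin_pi_div_two] at h1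
    refine pow_ne_zero 2 fun h => ?_
    rw [h, zero_mul] at h1
    exact zero_ne_one h1
  have hnf : 0 < normPW p f := normPW_pos hp hfmem hf0
  set m := normPW p f with hm
  set n := normPW p (sincScaled τ) with hn
  have hn0 : 0 ≤ n := normPW_nonneg p _
  -- The threshold is the largest `R` allowed by `hfin` below.
  obtain ⟨R, hR₁, hR₂⟩ : ∃ R, R₀ ≤ R ∧ 2 * N * K * (C * n) / (c * m) < R :=
    ⟨max R₀ (2 * N * K * (C * n) / (c * m) + 1), le_max_left _ _,
      (lt_add_one _).trans_le (le_max_right _ _)⟩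
  have hR : 0 < R := hR₀.trans_le hR₁
  refine ⟨R, hR, fun x => ?_⟩
  by_contra! hx
  -- Vacuous for empty `Λ`, so that case needs no separate argument.
  have hfar : ∀ l ∈ Λ, R ≤ ‖l - x‖ := by
    intro l hl
    have h1 := hx.trans (Metric.infEDist_le_edist_of_mem hl)
    rwa [edist_dist, ENNReal.ofReal_le_ofReal_iff dist_nonneg, dist_comm, dist_eq_norm] at h1
  have htrans : ∀ t : ℝ, P.normPow τ p (restriction Λ fun z => sincScaled τ (z - t)) ≤
      ENNReal.ofReal ((C * n) ^ p) := by
    intro t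
    have hmem := comp_sub_mem_PW hτ hSmem t
    refine P.normPow_le_of_normX_le hp0 (hbij.mapsTo hmem) ?_
    rw [hn, ← normPW_comp_sub p (sincScaled τ) t]
    exact (hnorm _ hmem).2
  have hfx := comp_sub_mem_PW hτ hfmem x
  have hlow : ENNReal.ofReal ((c * m) ^ p) ≤
      P.normPow τ p (restriction Λ fun z => f (z - x)) := by
    refine P.le_normPow_of_le_normX hp0 (by positivity) ?_
    rw [hm, ← normPW_comp_sub p f x]
    exact (hnorm _ hfx).1
  have hup := hpow R hR₁ x hfar (fun z => f (z - x)) hfx.1 fun z => by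
    have h1 := pow_le_pow_left₀ (by positivity) (norm_sincScaled_mul_le hτ2 (z - x)) 2
    rw [mul_pow, hexp, ← norm_pow] at h1
    simpa [hf] using h1
  have htot := (hlow.trans hup).trans (mul_le_mul_right (add_le_add (htrans _) (htrans _)) _)
  rw [← ENNReal.ofReal_add (by positivity) (by positivity), ← ENNReal.ofReal_mul (by positivity),
    ENNReal.ofReal_le_ofReal_iff (by positivity)] at htot
  have hN' : (1 : ℝ) ≤ N := by exact_mod_cast hN
  have hfin : (c * m) ^ p ≤ (2 * N * K * (C * n) / R) ^ p := by
    calc (c * m) ^ p ≤ 2 * N * ((K / R) ^ p * (C * n) ^ p) := by linarith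
      -- Since `2 * N ≥ 1` and `p ≥ 1`, raising the prefactor to the power `p` only loses, and then
      -- `p`-th roots can be taken.
      _ ≤ (2 * N) ^ p * ((K / R) ^ p * (C * n) ^ p) := by
        gcongr
        exact Real.self_le_rpow_of_one_le (by linarith) hp.le
      _ = (2 * N * K * (C * n) / R) ^ p := by
        rw [← Real.mul_rpow (by positivity) (by positivity),
          ← Real.mul_rpow (by positivity) (by positivity)]
        congr 1
        ring
  have h1 := (Real.rpow_le_rpow_iff (by positivity) (by positivity) hp0).1 hfin
  rw [div_lt_comm₀ (by positivity) hR] at hR₂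
  linarith
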